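/- Let $R$ be a commutative Noetherian ring with identity, $\mathfrak a$ an ideal of $R$, $M$ a finitely generated $R$-module, $N$ an $R$-module, and $t\ge 0$ an integer. An $R$-module is called weakly Laskerian if each of its quotient modules has only finitely many associated primes. For $i\ge 0$ put $$H^i_{\mathfrak a}(N)=\varinjlim_n \operatorname{Ext}^i_R(R/\mathfrak a^n,N),\qquad H^i_{\mathfrak a}(M,N)=\varinjlim_n \operatorname{Ext}^i_R(M/\mathfrak a^nM,N).$$ Suppose that $N$ is weakly Laskerian. If $H^i_{\mathfrak a}(N)$ is weakly Laskerian for all $i<t$, then $\operatorname{Ass}_R(H^t_{\mathfrak a}(M,N))$ is finite. In particular, $\operatorname{Ass}_R(H^t_{\mathfrak a}(M,N))$ is finite if, for each $i<t$, the module $H^i_{\mathfrak a}(N)$ is finitely generated or $\operatorname{Supp}_R(H^i_{\mathfrak a}(N))$ is finite. -/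

import Mathlib

open CategoryTheory

universe u

/-- An `R`-module is weakly Laskerian if each of its quotients has only finitely many
associated primes. -/
def IsWeaklyLaskerian (R : Type*) [CommRing R] (N : Type*) [AddCommGroup N] [Module R N] : Prop :=
  ∀ L : Submodule R N, (associatedPrimes R (N ⧸ L)).Finite

namespace GeneralizedLocalCohomology

/-- The inverse system `⋯ → M ⧸ a ^ 2 M → M ⧸ a M → M ⧸ a ^ 0 M` with the canonical projections. -/
def modIdealPowers {R : Type u} [CommRing R] (a : Ideal R)
    (M : Type u) [AddCommGroup M] [Module R M] : ℕᵒᵖ ⥤ ModuleCat.{u} R where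
  obj n := ModuleCat.of R (M ⧸ (a ^ n.unop • (⊤ : Submodule R M)))
  map w := ModuleCat.ofHom <| Submodule.mapQ _ _ LinearMap.id
    (Submodule.smul_mono_left (Ideal.pow_le_pow_right w.unop.le))
  map_id _ := by
    ext x
    rfl
  map_comp _ _ := by
    ext x
    rfl

/-- The direct system `n ↦ Ext^i(M ⧸ a ^ n M, -)`. -/
noncomputable def diagram {R : Type u} [CommRing R] (a : Ideal R) (i : ℕ)
    (M : Type u) [AddCommGroup M] [Module R M] :
    ℕᵒᵖᵒᵖ ⥤ ModuleCat.{u} R ⥤ ModuleCat.{u} R :=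
  (modIdealPowers a M).op ⋙ Ext R (ModuleCat.{u} R) i

end GeneralizedLocalCohomology

/-- The generalized local cohomology functor `N ↦ H^i_a(M, N)`, the direct limit over `n` of
`Ext^i(M ⧸ a ^ n M, N)`. The ordinary local cohomology functor `N ↦ H^i_a(N)` is Mathlib's
`localCohomology a i`, the direct limit over `n` of `Ext^i(R ⧸ a ^ n, N)`. -/
noncomputable def generalizedLocalCohomology {R : Type u} [CommRing R] (a : Ideal R) (i : ℕ)
    (M : Type u) [AddCommGroup M] [Module R M] : ModuleCat.{u} R ⥤ ModuleCat.{u} R :=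
  Limits.colimit (GeneralizedLocalCohomology.diagram a i M)

/-! The proof is by induction on `t`, with `N` varying. Let Γ be the `a`-power torsion of `N` and Q
= N/Γ. For `t > 0`, Γ is a quotient of H^0_a(N), hence weakly Laskerian. Over a Noetherian ring Q
embeds in an injective E without `a`-torsion. All Ext^i(M/a^n M, E) vanish, including i = 0, so with
N' = E/Q one gets H^i_a(M, N') ≅ H^{i+1}_a(M, Q), and the degree drops by one. Torsion modules are
controlled by `toExt_injective_of_powTorsion_eq_top`: H^i_a(M, Γ) embeds in Ext^i(M, Γ), which is
weakly Laskerian, and which vanishes for M = R and i > 0. So H^{i+1}_a(N) maps onto H^{i+1}_a(Q),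
which passes the hypotheses to N', and H^t_a(M, N) lies between a weakly Laskerian module and
H^t_a(M, Q). As a quotient of an injective, N' need not be weakly Laskerian. The induction therefore
only assumes that Ext^t(M/aM, N) is, which suffices for t = 0 because Ass H^0_a(M, N) ⊆ Ass
Hom(M/aM, N). -/

namespace IsWeaklyLaskerian

/-! ### Closure properties of weakly Laskerian modules -/

variable {R : Type*} [CommRing R] {X Y Z : Type*} [AddCommGroup X] [Module R X]
  [AddCommGroup Y] [Module R Y] [AddCommGroup Z] [Module R Z]

theorem finite_associatedPrimes (h : IsWeaklyLaskerian R X) : (associatedPrimes R X).Finite := by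
  rw [← LinearEquiv.AssociatedPrimes.eq (Submodule.quotEquivOfEqBot (⊥ : Submodule R X) rfl)]
  exact h ⊥

theorem of_injective (h : IsWeaklyLaskerian R Y) (f : X →ₗ[R] Y) (hf : Function.Injective f) :
    IsWeaklyLaskerian R X := by
  intro L
  refine (h (L.map f)).subset (associatedPrimes.subset_of_injective
    (f := Submodule.mapQ L (L.map f) f (Submodule.le_comap_map f L)) ?_)
  rw [← LinearMap.ker_eq_bot, Submodule.ker_mapQ, Submodule.comap_map_eq_of_injective hf,
    Submodule.mkQ_map_self]

theorem of_surjective (h : IsWeaklyLaskerian R X) (f : X →ₗ[R] Y) (hf : Function.Surjective f) :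
    IsWeaklyLaskerian R Y := by
  intro L
  have e : (X ⧸ (L.comap f)) ≃ₗ[R] Y ⧸ L := by
    refine LinearEquiv.ofBijective (Submodule.mapQ (L.comap f) L f le_rfl) ⟨?_, ?_⟩
    · rw [← LinearMap.ker_eq_bot, Submodule.ker_mapQ, Submodule.mkQ_map_self]
    · intro y
      obtain ⟨y, rfl⟩ := L.mkQ_surjective y
      obtain ⟨x, rfl⟩ := hf y
      exact ⟨(L.comap f).mkQ x, rfl⟩
  rw [← LinearEquiv.AssociatedPrimes.eq e]
  exact h _

/-- For `L ≤ Y`, the sequence 0 → X/f⁻¹(L) → Y/L → Z/g(L) is exact, so Ass(Y/L) is contained in the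
union of the outer two sets. -/
theorem of_exact (hX : IsWeaklyLaskerian R X) (hZ : IsWeaklyLaskerian R Z) (f : X →ₗ[R] Y)
    (g : Y →ₗ[R] Z) (hfg : Function.Exact f g) : IsWeaklyLaskerian R Y := by
  intro L
  let p : (X ⧸ L.comap f) →ₗ[R] Y ⧸ L := Submodule.mapQ (L.comap f) L f le_rfl
  let q : (Y ⧸ L) →ₗ[R] Z ⧸ L.map g := Submodule.mapQ L (L.map g) g (Submodule.le_comap_map g L)
  have hp : Function.Injective p := by
    rw [← LinearMap.ker_eq_bot, Submodule.ker_mapQ, Submodule.mkQ_map_self]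
  have hpq : Function.Exact p q := by
    intro y
    obtain ⟨y, rfl⟩ := L.mkQ_surjective y
    constructor
    · intro h
      obtain ⟨l, hl, hly⟩ := (Submodule.Quotient.mk_eq_zero _).1 h
      obtain ⟨x, hx⟩ := (hfg (y - l)).1 (by rw [map_sub, hly, sub_self])
      refine ⟨Submodule.Quotient.mk x, (Submodule.Quotient.eq L).2 ?_⟩
      rw [hx]
      simpa using hl
    · rintro ⟨x, hx⟩
      obtain ⟨x, rfl⟩ := Submodule.mkQ_surjective _ x
      rw [← hx]
      refine (Submodule.Quotient.mk_eq_zero _).2 ?_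
      rw [hfg.apply_apply_eq_zero]
      exact zero_mem _
  exact ((hX _).union (hZ _)).subset (associatedPrimes.subset_union_of_exact hp hpq)

theorem of_subsingleton [Subsingleton X] : IsWeaklyLaskerian R X := by
  intro L
  rw [associatedPrimes.eq_empty_of_subsingleton]
  exact Set.finite_empty

theorem pi (h : IsWeaklyLaskerian R X) : ∀ n : ℕ, IsWeaklyLaskerian R (Fin n → X)
  | 0 => of_subsingleton
  | n + 1 => by
    refine of_exact h (pi h n) (LinearMap.single R (fun _ : Fin (n + 1) => X) 0)
      (LinearMap.funLeft R X Fin.succ) fun y => ?_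
    constructor
    · intro hy
      refine ⟨y 0, ?_⟩
      funext i
      refine Fin.cases (by simp) (fun j => ?_) i
      simpa using (congrFun hy j).symm
    · rintro ⟨x, rfl⟩
      funext j
      simp [LinearMap.funLeft_apply]

theorem of_finite [IsNoetherianRing R] [Module.Finite R X] : IsWeaklyLaskerian R X :=
  fun _ => associatedPrimes.finite R _

/-- A prime associated to a quotient of `X` contains the annihilator of a lift to `X` of its
witness, hence lies in the support of `X`. -/
theorem of_finite_support [IsNoetherianRing R] (h : (Module.support R X).Finite) :
    IsWeaklyLaskerian R X := by
  intro L
  refine (h.image PrimeSpectrum.asIdeal).subset fun p hp => ?_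
  obtain ⟨hp, x, hx⟩ := isAssociatedPrime_iff.1 hp
  obtain ⟨y, rfl⟩ := L.mkQ_surjective x
  refine ⟨⟨p, hp⟩, Module.mem_support_iff_exists_annihilator.2 ⟨y, fun r hr => ?_⟩, rfl⟩
  rw [Submodule.mem_annihilator_span_singleton] at hr
  change r ∈ p
  rw [hx, Submodule.mem_colon_singleton, ← map_smul, hr, map_zero]
  exact zero_mem _

/-- If the first term of an exact sequence is weakly Laskerian and the last one has finitely many
associated primes, then the middle term has finitely many associated primes. -/
theorem finite_associatedPrimes_of_exact (hX : IsWeaklyLaskerian R X)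
    (hZ : (associatedPrimes R Z).Finite) (f : X →ₗ[R] Y) (g : Y →ₗ[R] Z)
    (hfg : Function.Exact f g) : (associatedPrimes R Y).Finite := by
  have hrange : IsWeaklyLaskerian R (LinearMap.range f) :=
    hX.of_surjective f.rangeRestrict f.surjective_rangeRestrict
  refine (hrange.finite_associatedPrimes.union hZ).subset
    (associatedPrimes.subset_union_of_exact (LinearMap.range f).injective_subtype (g := g) ?_)
  rw [LinearMap.exact_iff, Submodule.range_subtype, hfg.linearMap_ker_eq]

end IsWeaklyLaskerian

/-! ### Torsion with respect to powers of an ideal -/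

section PowTorsion

variable {R : Type*} [CommRing R] (a : Ideal R) (N : Type*) [AddCommGroup N] [Module R N]

/-- The submodule of the elements that are annihilated by some power of `a`. -/
def powTorsion : Submodule R N where
  carrier := {x | ∃ n : ℕ, ∀ r ∈ a ^ n, r • x = 0}
  add_mem' := by
    rintro x y ⟨m, hm⟩ ⟨n, hn⟩
    refine ⟨max m n, fun r hr => ?_⟩
    rw [smul_add, hm r (Ideal.pow_le_pow_right (le_max_left m n) hr),
      hn r (Ideal.pow_le_pow_right (le_max_right m n) hr), add_zero]
  zero_mem' := ⟨0, fun r _ => smul_zero r⟩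
  smul_mem' := by
    rintro c x ⟨n, hn⟩
    exact ⟨n, fun r hr => by rw [smul_comm, hn r hr, smul_zero]⟩

variable {a N}

lemma exists_pow_smul_eq_zero_of_fg {S : Submodule R N} (hS : S.FG) (h : S ≤ powTorsion a N) :
    ∃ n : ℕ, ∀ r ∈ a ^ n, ∀ x ∈ S, r • x = 0 := by
  induction S, hS using Submodule.fg_induction with
  | singleton x =>
    obtain ⟨n, hn⟩ := h (Submodule.mem_span_singleton_self x)
    refine ⟨n, fun r hr y hy => ?_⟩
    obtain ⟨c, rfl⟩ := Submodule.mem_span_singleton.1 hy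
    rw [smul_comm, hn r hr, smul_zero]
  | sup S T _ _ hS hT =>
    obtain ⟨m, hm⟩ := hS (le_sup_left.trans h)
    obtain ⟨n, hn⟩ := hT (le_sup_right.trans h)
    refine ⟨max m n, fun r hr x hx => ?_⟩
    obtain ⟨y, hy, z, hz, rfl⟩ := Submodule.mem_sup.1 hx
    rw [smul_add, hm r (Ideal.pow_le_pow_right (le_max_left m n) hr) y hy,
      hn r (Ideal.pow_le_pow_right (le_max_right m n) hr) z hz, add_zero]

/-- If `a ^ n` sends `x` into the torsion, then `a ^ n • x` is a finitely generated torsion module,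
so a single `a ^ m` kills it and `a ^ (m + n)` kills `x`. -/
lemma powTorsion_quotient [IsNoetherianRing R] : powTorsion a (N ⧸ powTorsion a N) = ⊥ := by
  refine (Submodule.eq_bot_iff _).2 fun x hx => ?_
  obtain ⟨n, hn⟩ := hx
  obtain ⟨x, rfl⟩ := Submodule.mkQ_surjective _ x
  refine (Submodule.Quotient.mk_eq_zero _).2 ?_
  obtain ⟨m, hm⟩ := exists_pow_smul_eq_zero_of_fg (a := a)
    (S := Submodule.map (LinearMap.toSpanSingleton R N x) (a ^ n))
    (Submodule.FG.map _ ((isNoetherianRing_iff_ideal_fg R).1 inferInstance (a ^ n))) (by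
      rintro _ ⟨r, hr, rfl⟩
      exact (Submodule.Quotient.mk_eq_zero _).1 (hn r hr))
  refine ⟨m + n, fun r hr => ?_⟩
  have hle : a ^ (m + n) ≤ LinearMap.ker (LinearMap.toSpanSingleton R N x) := by
    rw [pow_add]
    refine Ideal.mul_le.2 fun s hs t ht => ?_
    change (s * t) • x = 0
    rw [mul_smul]
    exact hm s hs _ ⟨t, ht, rfl⟩
  exact hle hr

lemma exists_pow_smul_map_eq_zero {M : Type*} [AddCommGroup M] [Module R M] [Module.Finite R M]
    (hN : powTorsion a N = ⊤) (f : M →ₗ[R] N) : ∃ n : ℕ, ∀ r ∈ a ^ n, ∀ x, r • f x = 0 := by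
  obtain ⟨n, hn⟩ := exists_pow_smul_eq_zero_of_fg (a := a)
    (S := LinearMap.range f) (Module.Finite.fg_top.map f |> fun h => by rwa [← Submodule.map_top])
    (hN ▸ le_top)
  exact ⟨n, fun r hr x => hn r hr _ ⟨x, rfl⟩⟩

lemma powTorsion_eq_top_of_surjective {M : Type*} [AddCommGroup M] [Module R M]
    (hN : powTorsion a N = ⊤) (f : N →ₗ[R] M) (hf : Function.Surjective f) :
    powTorsion a M = ⊤ := by
  refine (Submodule.eq_top_iff').2 fun y => ?_
  obtain ⟨x, rfl⟩ := hf y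
  obtain ⟨n, hn⟩ := (Submodule.eq_top_iff').1 hN x
  exact ⟨n, fun r hr => by rw [← map_smul, hn r hr, map_zero]⟩

lemma powTorsion_self : powTorsion a (powTorsion a N) = ⊤ := by
  refine (Submodule.eq_top_iff').2 fun ⟨x, n, hn⟩ => ⟨n, fun r hr => Subtype.ext (hn r hr)⟩

end PowTorsion

/-! ### Torsion and torsion-free injectives over a Noetherian ring -/

section Injective

lemma exists_injective_embedding {R : Type u} [CommRing R] (N : Type u) [AddCommGroup N]
    [Module R N] :
    ∃ (E : ModuleCat.{u} R) (f : N →ₗ[R] E), Module.Injective R E ∧ Function.Injective f :=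
  ⟨Injective.under (ModuleCat.of R N), (Injective.ι (ModuleCat.of R N)).hom,
    (Module.injective_iff_injective_object R _).2
      (inferInstanceAs (Injective (Injective.under (ModuleCat.of R N)))),
    (ModuleCat.mono_iff_injective (Injective.ι (ModuleCat.of R N))).1 inferInstance⟩

variable {R : Type u} [CommRing R] [IsNoetherianRing R] (a : Ideal R)
  (E : Type u) [AddCommGroup E] [Module R E] [Module.Injective R E]

/-- Baer's criterion and Artin–Rees: `g : I → Γ(E)` is killed by some `a ^ n`, and I ∩ a^(n+k) ⊆ a^n
I ⊆ ker g. So `g` factors through a submodule of R/a^(n+k); extending to that quotient with values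
in `E` gives values that are torsion automatically. -/
instance powTorsion_injective : Module.Injective R (powTorsion a E) := by
  refine Module.Baer.injective fun I g => ?_
  obtain ⟨n, hn⟩ := exists_pow_smul_map_eq_zero (a := a) powTorsion_self g
  obtain ⟨k, hk⟩ := a.exists_pow_inf_eq_pow_smul (M := R) I
  have hle : Submodule.comap I.subtype (a ^ (n + k)) ≤ LinearMap.ker g := by
    intro x hx
    have hx' : (x : R) ∈ a ^ n • I := by
      have h : (x : R) ∈ a ^ (n + k) • (⊤ : Submodule R R) ⊓ I := by
        refine ⟨?_, x.2⟩
        rw [smul_eq_mul, Ideal.mul_top]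
        exact hx
      rw [hk (n + k) (by lia), Nat.add_sub_cancel] at h
      exact Submodule.smul_mono le_rfl inf_le_right h
    have key : a ^ n • I ≤ (LinearMap.ker g).map I.subtype := by
      refine Submodule.smul_le.2 fun r hr y hy => ⟨r • ⟨y, hy⟩, ?_, rfl⟩
      rw [SetLike.mem_coe, LinearMap.mem_ker, map_smul, hn r hr]
    obtain ⟨y, hy, hyx⟩ := key hx'
    obtain rfl : y = x := Subtype.ext hyx
    exact hy
  obtain ⟨h, hh⟩ := Module.Injective.out
    (Submodule.mapQ (Submodule.comap I.subtype (a ^ (n + k))) (a ^ (n + k)) I.subtype le_rfl)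
    (by rw [← LinearMap.ker_eq_bot, Submodule.ker_mapQ, Submodule.mkQ_map_self])
    ((powTorsion a E).subtype ∘ₗ Submodule.liftQ _ g hle)
  have hmem : ∀ x : R, h (Submodule.Quotient.mk x) ∈ powTorsion a E := fun x =>
    ⟨n + k, fun r hr => by
      rw [← map_smul, ← Submodule.Quotient.mk_smul,
        (Submodule.Quotient.mk_eq_zero _).2
        (show r • x ∈ a ^ (n + k) from Ideal.mul_mem_right x _ hr), map_zero]⟩
  refine ⟨(h ∘ₗ Submodule.mkQ _).codRestrict _ hmem, fun x hx => Subtype.ext ?_⟩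
  exact hh (Submodule.Quotient.mk ⟨x, hx⟩)

/-- The torsion submodule is injective, hence a direct summand; `s` embeds the quotient as a
complement. -/
instance quotient_powTorsion_injective : Module.Injective R (E ⧸ powTorsion a E) := by
  obtain ⟨p, hp⟩ := Module.Injective.out (powTorsion a E).subtype
    (powTorsion a E).injective_subtype (LinearMap.id : powTorsion a E →ₗ[R] powTorsion a E)
  let s : (E ⧸ powTorsion a E) →ₗ[R] E :=
    Submodule.liftQ _ (LinearMap.id - (powTorsion a E).subtype ∘ₗ p) fun x hx => by
      have := hp ⟨x, hx⟩
      simp only [Submodule.subtype_apply, LinearMap.id_coe, id_eq] at this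
      simp [this]
  have hs : ∀ y, Submodule.mkQ _ (s y) = y := by
    intro y
    obtain ⟨x, rfl⟩ := Submodule.mkQ_surjective _ y
    change Submodule.Quotient.mk (x - (p x : E)) = Submodule.Quotient.mk x
    rw [Submodule.Quotient.eq]
    simp
  constructor
  intro X Y _ _ _ _ f hf g
  obtain ⟨h, hh⟩ := Module.Injective.out f hf (s ∘ₗ g)
  exact ⟨Submodule.mkQ _ ∘ₗ h, fun x => by simp [hh, hs]⟩

variable {N : Type u} [AddCommGroup N] [Module R N]

lemma exists_injective_embedding_of_powTorsion_eq_top (hN : powTorsion a N = ⊤) :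
    ∃ (E : ModuleCat.{u} R) (f : N →ₗ[R] E),
      Module.Injective R E ∧ powTorsion a E = ⊤ ∧ Function.Injective f := by
  obtain ⟨E, f, hE, hf⟩ := exists_injective_embedding (R := R) N
  refine ⟨ModuleCat.of R (powTorsion a E), f.codRestrict _ fun x => ?_,
    powTorsion_injective a E, powTorsion_self, fun x y h => hf (congrArg Subtype.val h)⟩
  obtain ⟨n, hn⟩ := (Submodule.eq_top_iff').1 hN x
  exact ⟨n, fun r hr => by rw [← map_smul, hn r hr, map_zero]⟩

lemma exists_injective_embedding_of_powTorsion_eq_bot (hN : powTorsion a N = ⊥) :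
    ∃ (E : ModuleCat.{u} R) (f : N →ₗ[R] E),
      Module.Injective R E ∧ powTorsion a E = ⊥ ∧ Function.Injective f := by
  obtain ⟨E, f, hE, hf⟩ := exists_injective_embedding (R := R) N
  refine ⟨ModuleCat.of R (E ⧸ powTorsion a E), Submodule.mkQ _ ∘ₗ f,
    quotient_powTorsion_injective a E, powTorsion_quotient, ?_⟩
  rw [← LinearMap.ker_eq_bot, LinearMap.ker_comp, Submodule.ker_mkQ, Submodule.eq_bot_iff]
  rintro x ⟨n, hn⟩
  rw [← Submodule.mem_bot (R := R), ← hN]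
  exact ⟨n, fun r hr => hf (by rw [map_smul, hn r hr, map_zero])⟩

end Injective

/-! ### Hom and Ext into weakly Laskerian modules -/

namespace IsWeaklyLaskerian

variable {R : Type u} [CommRing R] {X : ModuleCat.{u} R}

lemma hom {L : ModuleCat.{u} R} [Module.Finite R L] (hX : IsWeaklyLaskerian R X) :
    IsWeaklyLaskerian R (L ⟶ X) := by
  obtain ⟨n, p, hp⟩ := Module.Finite.exists_fin' R L
  refine (hX.pi n).of_injective
    { toFun := fun f i => f.hom (p (Pi.single i 1))
      map_add' := fun f g => rfl
      map_smul' := fun r f => rfl } fun f g hfg => ?_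
  refine ModuleCat.hom_ext ?_
  have h : f.hom ∘ₗ p = g.hom ∘ₗ p := LinearMap.pi_ext' fun i => LinearMap.ext_ring (congrFun hfg i)
  exact LinearMap.ext fun x => by
    obtain ⟨y, rfl⟩ := hp x
    exact LinearMap.congr_fun h y

/-- `Ext` from a finitely generated module to a weakly Laskerian module is weakly Laskerian. -/
theorem ext [IsNoetherianRing R] (hX : IsWeaklyLaskerian R X) (i : ℕ) (L : ModuleCat.{u} R)
    [Module.Finite R L] : IsWeaklyLaskerian R (Abelian.Ext L X i) := by
  induction i generalizing L with
  | zero =>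
    exact (hX.hom (L := L)).of_injective (Abelian.Ext.linearEquiv₀ (R := R)).toLinearMap
      (Abelian.Ext.linearEquiv₀ (R := R)).injective
  | succ i ih =>
    obtain ⟨n, p, hp⟩ := Module.Finite.exists_fin' R L
    have hS := LinearMap.shortExact_shortComplexKer hp
    have : Module.Finite R (ModuleCat.of R (LinearMap.ker p)) :=
      inferInstanceAs (Module.Finite R (LinearMap.ker p))
    -- Dimension shifting along 0 → K → R^n → L → 0: the connecting map Ext^i(K, X) → Ext^(i+1)(L,
    -- X) is onto because Ext^(i+1)(R^n, X) = 0.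
    refine (ih (ModuleCat.of R (LinearMap.ker p))).of_surjective
      (hS.extClass.precompOfLinear R X (add_comm 1 i)) fun x => ?_
    have : Projective (ModuleCat.of R (Fin n → R)) :=
      (IsProjective.iff_projective _).1 inferInstance
    exact Abelian.Ext.contravariant_sequence_exact₃ hS X x
      (Abelian.Ext.eq_zero_of_projective _) (add_comm 1 i)

end IsWeaklyLaskerian

/-! ### Direct limits of Ext and their long exact sequences -/

section ExtLimit

open Opposite

variable {R : Type u} [CommRing R] (D : ℕᵒᵖ ⥤ ModuleCat.{u} R)

/-- The transition maps of the direct system `n ↦ Ext^i(D n, X)`. -/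
noncomputable def extTransition (X : ModuleCat.{u} R) (i m n : ℕ) (h : m ≤ n) :
    Abelian.Ext (D.obj (op m)) X i →ₗ[R] Abelian.Ext (D.obj (op n)) X i :=
  (Abelian.Ext.mk₀ (D.map (homOfLE h).op)).precompOfLinear R X (zero_add i)

lemma extTransition_apply {X : ModuleCat.{u} R} {i m n : ℕ} (h : m ≤ n)
    (x : Abelian.Ext (D.obj (op m)) X i) :
    extTransition D X i m n h x = (Abelian.Ext.mk₀ (D.map (homOfLE h).op)).comp x (zero_add i) :=
  rfl

instance (X : ModuleCat.{u} R) (i : ℕ) :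
    DirectedSystem (fun n => Abelian.Ext (D.obj (op n)) X i)
      (fun m n h => extTransition D X i m n h) where
  map_self n x := by
    rw [extTransition_apply, show (homOfLE le_rfl).op = 𝟙 (op n) from rfl, D.map_id,
      Abelian.Ext.mk₀_id_comp]
  map_map k m n hkm hmn x := by
    rw [extTransition_apply, extTransition_apply, extTransition_apply,
      Abelian.Ext.mk₀_comp_mk₀_assoc, ← D.map_comp]
    rfl

/-- The direct limit over `n` of `Ext^i(D n, X)`. -/
abbrev ExtLimit (X : ModuleCat.{u} R) (i : ℕ) : Type u :=
  Module.DirectLimit (fun n => Abelian.Ext (D.obj (op n)) X i)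
    (fun m n h => extTransition D X i m n h)

namespace ExtLimit

variable {D} {X Y Z : ModuleCat.{u} R}

/-- The canonical map `Ext^i(D n, X) → ExtLimit D X i`. -/
noncomputable abbrev of {i : ℕ} (n : ℕ) : Abelian.Ext (D.obj (op n)) X i →ₗ[R] ExtLimit D X i :=
  Module.DirectLimit.of R ℕ (fun n => Abelian.Ext (D.obj (op n)) X i)
    (fun m n h => extTransition D X i m n h) n

lemma exists_of {i : ℕ} (x : ExtLimit D X i) : ∃ n y, of (D := D) (X := X) n y = x :=
  Module.DirectLimit.exists_of x

lemma of_comp_eq {i m n : ℕ} (h : m ≤ n) (x : Abelian.Ext (D.obj (op m)) X i) :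
    of n ((Abelian.Ext.mk₀ (D.map (homOfLE h).op)).comp x (zero_add i)) = of m x :=
  Module.DirectLimit.of_f (R := R) (G := fun n => Abelian.Ext (D.obj (op n)) X i)
    (f := fun m n h => extTransition D X i m n h) (hij := h)

lemma of_eq_zero {i n : ℕ} {x : Abelian.Ext (D.obj (op n)) X i} (hx : of n x = 0) :
    ∃ (m : ℕ) (h : n ≤ m), (Abelian.Ext.mk₀ (D.map (homOfLE h).op)).comp x (zero_add i) = 0 :=
  Module.DirectLimit.of.zero_exact (R := R) (G := fun n => Abelian.Ext (D.obj (op n)) X i)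
    (f := fun m n h => extTransition D X i m n h) hx

/-- Composition with an extension class. -/
noncomputable def postcomp {i j k : ℕ} (α : Abelian.Ext X Y j) (h : i + j = k) :
    ExtLimit D X i →ₗ[R] ExtLimit D Y k :=
  Module.DirectLimit.map (G := fun n => Abelian.Ext (D.obj (op n)) X i)
    (f := fun m n h => extTransition D X i m n h) (G' := fun n => Abelian.Ext (D.obj (op n)) Y k)
    (f' := fun m n h => extTransition D Y k m n h)
    (fun n => α.postcompOfLinear R (D.obj (op n)) h) fun m n hmn => LinearMap.ext fun x =>
      Abelian.Ext.comp_assoc (Abelian.Ext.mk₀ (D.map (homOfLE hmn).op)) x α (zero_add i) h (by lia)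

lemma postcomp_of {i j k : ℕ} (α : Abelian.Ext X Y j) (h : i + j = k) (n : ℕ)
    (x : Abelian.Ext (D.obj (op n)) X i) : postcomp α h (of n x) = of n (x.comp α h) :=
  Module.DirectLimit.map_apply_of (R := R) (G := fun n => Abelian.Ext (D.obj (op n)) X i)
    (f := fun m n h => extTransition D X i m n h) _ _ x

/-- Direct limits over ℕ are exact: a class that dies in the limit dies at a finite stage, where
`hex` supplies a preimage. -/
lemma exact_postcomp {i p j q k : ℕ} (α : Abelian.Ext X Y p) (β : Abelian.Ext Y Z q)
    (hij : i + p = j) (hjk : j + q = k) (h0 : α.comp β rfl = 0)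
    (hex : ∀ (L : ModuleCat.{u} R) (y : Abelian.Ext L Y j), y.comp β hjk = 0 →
      ∃ x : Abelian.Ext L X i, x.comp α hij = y) :
    Function.Exact (postcomp (D := D) α hij) (postcomp β hjk) := by
  intro y
  constructor
  · intro hy
    obtain ⟨n, y, rfl⟩ := exists_of y
    rw [postcomp_of] at hy
    obtain ⟨m, hnm, hy⟩ := of_eq_zero hy
    rw [← Abelian.Ext.comp_assoc _ _ _ (zero_add j) hjk (by lia)] at hy
    obtain ⟨x, hx⟩ := hex _ _ hy
    exact ⟨of m x, by rw [postcomp_of, hx, of_comp_eq]⟩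
  · rintro ⟨x, rfl⟩
    obtain ⟨n, x, rfl⟩ := exists_of x
    rw [postcomp_of, postcomp_of, Abelian.Ext.comp_assoc _ _ _ hij rfl (by lia), h0,
      Abelian.Ext.comp_zero, map_zero]

section ShortExact

variable {S : ShortComplex (ModuleCat.{u} R)} (hS : S.ShortExact) (i : ℕ)

include hS in
lemma exact₂ : Function.Exact (postcomp (D := D) (Abelian.Ext.mk₀ S.f) (add_zero i))
    (postcomp (Abelian.Ext.mk₀ S.g) (add_zero i)) :=
  exact_postcomp _ _ _ _ (by simp) fun L y hy => Abelian.Ext.covariant_sequence_exact₂ L hS y hy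

lemma exact₃ : Function.Exact (postcomp (D := D) (Abelian.Ext.mk₀ S.g) (add_zero i))
    (postcomp hS.extClass (rfl : i + 1 = i + 1)) :=
  exact_postcomp _ _ _ _ (by simp) fun L y hy =>
    Abelian.Ext.covariant_sequence_exact₃ L hS y rfl hy

lemma exact₁ : Function.Exact (postcomp (D := D) hS.extClass (rfl : i + 1 = i + 1))
    (postcomp (Abelian.Ext.mk₀ S.f) (add_zero (i + 1))) :=
  exact_postcomp _ _ _ _ (by simp) fun L y hy =>
    Abelian.Ext.covariant_sequence_exact₁ L hS y hy rfl

end ShortExact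

lemma subsingleton_of_injective [Injective X] (i : ℕ) : Subsingleton (ExtLimit D X (i + 1)) := by
  refine subsingleton_of_forall_eq 0 fun x => ?_
  obtain ⟨n, x, rfl⟩ := exists_of x
  rw [x.eq_zero_of_injective, map_zero]

variable {M : ModuleCat.{u} R} (π : (Functor.const ℕᵒᵖ).obj M ⟶ D)

/-- The map `ExtLimit D X i → Ext^i(M, X)` induced by a cone over `D` with apex `M`. -/
noncomputable def toExt (X : ModuleCat.{u} R) (i : ℕ) :
    ExtLimit D X i →ₗ[R] Abelian.Ext M X i :=
  Module.DirectLimit.lift R ℕ (fun n => Abelian.Ext (D.obj (op n)) X i)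
    (fun m n h => extTransition D X i m n h)
    (fun n => (Abelian.Ext.mk₀ (π.app (op n))).precompOfLinear R X (zero_add i)) fun m n h x => by
      change (Abelian.Ext.mk₀ _).comp ((Abelian.Ext.mk₀ _).comp x (zero_add i)) (zero_add i) =
        (Abelian.Ext.mk₀ _).comp x (zero_add i)
      rw [Abelian.Ext.mk₀_comp_mk₀_assoc, ← π.naturality]
      simp

lemma toExt_of {i : ℕ} (n : ℕ) (x : Abelian.Ext (D.obj (op n)) X i) :
    toExt π X i (of n x) = (Abelian.Ext.mk₀ (π.app (op n))).comp x (zero_add i) :=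
  Module.DirectLimit.lift_of (R := R) (G := fun n => Abelian.Ext (D.obj (op n)) X i)
    (f := fun m n h => extTransition D X i m n h) _ _ x

lemma toExt_postcomp {i j k : ℕ} (α : Abelian.Ext X Y j) (h : i + j = k) (x : ExtLimit D X i) :
    toExt π Y k (postcomp α h x) = (toExt π X i x).comp α h := by
  obtain ⟨n, x, rfl⟩ := exists_of x
  rw [postcomp_of, toExt_of, toExt_of, Abelian.Ext.comp_assoc _ _ _ (zero_add i) h (by lia)]

lemma toExt_zero_injective [∀ n, Epi (π.app n)] : Function.Injective (toExt π X 0) := by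
  rw [injective_iff_map_eq_zero]
  intro x hx
  obtain ⟨n, x, rfl⟩ := exists_of x
  rw [toExt_of] at hx
  have h := Abelian.Ext.precomp_mk₀_injective_of_epi X (π.app (op n))
  rw [(injective_iff_map_eq_zero _).1 h x hx, map_zero]

end ExtLimit

end ExtLimit

/-! ### Generalized local cohomology and the induction -/

section

open Opposite

variable {R : Type u} [CommRing R]

lemma Submodule.shortExact_mkQ {X : Type u} [AddCommGroup X] [Module R X] (L : Submodule R X) :
    (ModuleCat.shortComplexOfCompEqZero L.subtype L.mkQ (by ext x; simp)).ShortExact :=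
  ModuleCat.shortComplex_shortExact _ (LinearMap.exact_subtype_mkQ L) L.injective_subtype
    L.mkQ_surjective

lemma LinearMap.shortExact_mkQ_range {X Y : Type u} [AddCommGroup X] [Module R X] [AddCommGroup Y]
    [Module R Y] (f : X →ₗ[R] Y) (hf : Function.Injective f) :
    (ModuleCat.shortComplexOfCompEqZero f (LinearMap.range f).mkQ
      (LinearMap.range_mkQ_comp f)).ShortExact :=
  ModuleCat.shortComplex_shortExact _ (LinearMap.exact_map_mkQ_range f) hf
    (LinearMap.range f).mkQ_surjective

lemma Module.Injective.injective_obj (E : ModuleCat.{u} R) [Module.Injective R E] :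
    CategoryTheory.Injective E :=
  Module.injective_object_of_injective_module R E

namespace GeneralizedLocalCohomology

variable (a : Ideal R) (M : Type u) [AddCommGroup M] [Module R M]

/-- The canonical projections `M → M ⧸ a ^ n M`. -/
def powersCone : (Functor.const ℕᵒᵖ).obj (ModuleCat.of R M) ⟶ modIdealPowers a M where
  app _ := ModuleCat.ofHom (Submodule.mkQ _)
  naturality _ _ _ := rfl

instance (n : ℕᵒᵖ) : Epi ((powersCone a M).app n) :=
  (ModuleCat.epi_iff_surjective _).2 (Submodule.mkQ_surjective _)

instance [Module.Finite R M] (n : ℕᵒᵖ) : Module.Finite R ((modIdealPowers a M).obj n) :=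
  inferInstanceAs (Module.Finite R (M ⧸ (a ^ n.unop • (⊤ : Submodule R M))))

variable {a M}

lemma smul_modIdealPowers_eq_zero {n : ℕ} {r : R} (hr : r ∈ a ^ n)
    (x : (modIdealPowers a M).obj (op n)) : r • x = 0 := by
  obtain ⟨x, rfl⟩ := Submodule.mkQ_surjective _ x
  exact (Submodule.Quotient.mk_eq_zero (a ^ n • (⊤ : Submodule R M)) (x := r • x)).2
    (Submodule.smul_mem_smul hr trivial)

/-- A map `M → X` whose image is annihilated by `a ^ n` factors through `M ⧸ a ^ n M`. -/
lemma exists_powersCone_comp_eq {X : ModuleCat.{u} R} (f : ModuleCat.of R M ⟶ X) {n : ℕ}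
    (hn : ∀ r ∈ a ^ n, ∀ x, r • f.hom x = 0) :
    ∃ g : (modIdealPowers a M).obj (op n) ⟶ X, (powersCone a M).app (op n) ≫ g = f := by
  have hle : a ^ n • (⊤ : Submodule R M) ≤ LinearMap.ker f.hom :=
    Submodule.smul_le.2 fun r hr x _ => by rw [LinearMap.mem_ker, map_smul, hn r hr]
  exact ⟨ModuleCat.ofHom (Submodule.liftQ _ f.hom hle), rfl⟩

lemma toExt_zero_surjective [Module.Finite R M] {X : ModuleCat.{u} R}
    (hX : powTorsion a X = ⊤) : Function.Surjective (ExtLimit.toExt (powersCone a M) X 0) := by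
  intro x
  obtain ⟨f, rfl⟩ := Abelian.Ext.addEquiv₀.symm.surjective x
  obtain ⟨n, hn⟩ := exists_pow_smul_map_eq_zero hX f.hom
  obtain ⟨g, rfl⟩ := exists_powersCone_comp_eq f hn
  exact ⟨ExtLimit.of n (Abelian.Ext.mk₀ g), by
    rw [ExtLimit.toExt_of, Abelian.Ext.mk₀_comp_mk₀]; rfl⟩

/-- Dimension shifting: embed `X` in a torsion injective `E` and compare the long exact sequences of
0 → X → E → E/X → 0. The quotient E/X is again torsion, so a four-lemma chase applies. -/
theorem toExt_injective_of_powTorsion_eq_top [IsNoetherianRing R] [Module.Finite R M] (i : ℕ)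
    {X : ModuleCat.{u} R} (hX : powTorsion a X = ⊤) :
    Function.Injective (ExtLimit.toExt (powersCone a M) X i) := by
  induction i generalizing X with
  | zero => exact ExtLimit.toExt_zero_injective _
  | succ i ih =>
    obtain ⟨E, f, hE, hEa, hf⟩ := exists_injective_embedding_of_powTorsion_eq_top a hX
    have hEi : CategoryTheory.Injective E := Module.Injective.injective_obj E
    have hS := f.shortExact_mkQ_range hf
    have hX' : powTorsion a (E ⧸ LinearMap.range f) = ⊤ :=
      powTorsion_eq_top_of_surjective hEa _ (Submodule.mkQ_surjective _)
    rw [injective_iff_map_eq_zero]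
    intro y hy
    have : Subsingleton (ExtLimit (modIdealPowers a M) (ModuleCat.of R E) (i + 1)) :=
      ExtLimit.subsingleton_of_injective i
    obtain ⟨z, rfl⟩ := (ExtLimit.exact₁ hS i y).1 (Subsingleton.elim _ _)
    rw [ExtLimit.toExt_postcomp] at hy
    obtain ⟨w, hw⟩ := Abelian.Ext.covariant_sequence_exact₃ _ hS _ rfl hy
    -- `toExt` is onto for `E`: in degree 0 because `E` is torsion and `M` finitely generated, in
    -- higher degrees because Ext into `E` vanishes.
    obtain ⟨w', rfl⟩ : ∃ w', ExtLimit.toExt (powersCone a M) (ModuleCat.of R E) i w' = w := by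
      cases i with
      | zero => exact toExt_zero_surjective hEa w
      | succ i => exact ⟨0, by rw [map_zero, w.eq_zero_of_injective]⟩
    rw [← ExtLimit.toExt_postcomp] at hw
    rw [← ih hX' hw]
    exact (ExtLimit.exact₃ hS i _).2 ⟨w', rfl⟩

/-- In degree 0, a map from a module killed by `a ^ n` has torsion image, hence is zero. -/
lemma ext_subsingleton_of_injective {E : ModuleCat.{u} R} [CategoryTheory.Injective E]
    (hE : powTorsion a E = ⊥) (i n : ℕ) :
    Subsingleton (Abelian.Ext ((modIdealPowers a M).obj (op n)) E i) := by
  refine subsingleton_of_forall_eq 0 fun x => ?_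
  cases i with
  | zero =>
    obtain ⟨f, rfl⟩ := Abelian.Ext.addEquiv₀.symm.surjective x
    have hf : f = 0 := ModuleCat.hom_ext <| LinearMap.ext fun y => by
      change f.hom y = 0
      rw [← Submodule.mem_bot (R := R), ← hE]
      exact ⟨n, fun r hr => by rw [← map_smul, smul_modIdealPowers_eq_zero hr, map_zero]⟩
    rw [hf, map_zero]
  | succ i => exact x.eq_zero_of_injective

lemma extLimit_subsingleton_of_injective {E : ModuleCat.{u} R} [CategoryTheory.Injective E]
    (hE : powTorsion a E = ⊥) (i : ℕ) :
    Subsingleton (ExtLimit (modIdealPowers a M) E i) := by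
  refine subsingleton_of_forall_eq 0 fun x => ?_
  obtain ⟨n, x, rfl⟩ := ExtLimit.exists_of x
  rw [(ext_subsingleton_of_injective hE i n).elim x 0, map_zero]

/-- The associated primes of `H^0_a(M, X)` are associated primes of `Hom(M ⧸ aM, X)`. -/
theorem associatedPrimes_extLimit_zero_subset [IsNoetherianRing R] {X : ModuleCat.{u} R} :
    associatedPrimes R (ExtLimit (modIdealPowers a M) X 0) ⊆
      associatedPrimes R (Abelian.Ext ((modIdealPowers a M).obj (op 1)) X 0) := by
  intro p hp
  have hinj := ExtLimit.toExt_zero_injective (powersCone a M) (X := X)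
  obtain ⟨hpp, x, hx⟩ := isAssociatedPrime_iff.1 hp
  have hmem : ∀ r, r ∈ p ↔ r • x = 0 := fun r => by
    rw [hx, Submodule.mem_colon_singleton, Submodule.mem_bot]
  obtain ⟨f, hf⟩ := Abelian.Ext.addEquiv₀.symm.surjective (ExtLimit.toExt (powersCone a M) X 0 x)
  replace hf : Abelian.Ext.mk₀ f = ExtLimit.toExt (powersCone a M) X 0 x := hf
  have hmem' : ∀ r, r ∈ p ↔ r • f = 0 := fun r => by
    rw [hmem, ← hinj.eq_iff, map_zero, map_smul, ← hf, ← Abelian.Ext.mk₀_smul,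
      Abelian.Ext.mk₀_eq_zero_iff]
  -- The class `x` lives at some stage `n`, so `a ^ n` kills it and the prime `p` contains `a`.
  have hap : a ≤ p := by
    obtain ⟨n, y, rfl⟩ := ExtLimit.exists_of x
    refine hpp.le_of_pow_le (n := n) fun r hr => (hmem r).2 ?_
    obtain ⟨g, rfl⟩ := Abelian.Ext.addEquiv₀.symm.surjective y
    have hg : r • g = 0 := ModuleCat.hom_ext <| LinearMap.ext fun y => by
      change r • g.hom y = 0
      rw [← map_smul, smul_modIdealPowers_eq_zero hr, map_zero]
    change r • ExtLimit.of n (Abelian.Ext.mk₀ g) = 0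
    rw [← map_smul, ← Abelian.Ext.mk₀_smul, hg, Abelian.Ext.mk₀_zero, map_zero]
  -- Now `a` itself kills `f : M → X`, so `f` factors through M/aM with the same annihilator.
  obtain ⟨g, rfl⟩ := exists_powersCone_comp_eq (a := a) (n := 1) f fun r hr x => by
    rw [pow_one] at hr
    exact congrArg (fun h => h.hom x) ((hmem' r).1 (hap hr))
  refine isAssociatedPrime_iff.2 ⟨hpp, Abelian.Ext.mk₀ g, Ideal.ext fun r => ?_⟩
  rw [Submodule.mem_colon_singleton, Submodule.mem_bot, hmem', ← Abelian.Ext.mk₀_smul,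
    Abelian.Ext.mk₀_eq_zero_iff, ← Linear.comp_smul, ← cancel_epi ((powersCone a M).app (op 1)),
    Limits.comp_zero]

/-- The module `H^0_a(X)` surjects onto the `a`-power torsion submodule of `X`. -/
lemma isWeaklyLaskerian_powTorsion [IsNoetherianRing R] {X : ModuleCat.{u} R}
    (h : IsWeaklyLaskerian R (ExtLimit (modIdealPowers a R) X 0)) :
    IsWeaklyLaskerian R (powTorsion a X) := by
  have hS := (powTorsion a X).shortExact_mkQ
  have hmono := hS.mono_f
  set Γ : ModuleCat.{u} R := ModuleCat.of R (powTorsion a X)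
  have hinj : Function.Injective (ExtLimit.postcomp (D := modIdealPowers a R)
      (Abelian.Ext.mk₀ (ModuleCat.ofHom (powTorsion a X).subtype)) (add_zero 0)) := by
    rw [injective_iff_map_eq_zero]
    intro x hx
    refine ExtLimit.toExt_zero_injective (powersCone a R) ?_
    rw [map_zero]
    refine (injective_iff_map_eq_zero _).1 (Abelian.Ext.postcomp_mk₀_injective_of_mono
      (ModuleCat.of R R) (ModuleCat.ofHom (powTorsion a X).subtype)) _ ?_
    change (ExtLimit.toExt (powersCone a R) Γ 0 x).comp _ (add_zero 0) = 0
    rw [← ExtLimit.toExt_postcomp, hx, map_zero]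
  -- H^0_a(Γ) sits inside H^0_a(X) and maps onto Hom(R, Γ); evaluation at 1 then reaches Γ.
  have h1 : IsWeaklyLaskerian R (Abelian.Ext (ModuleCat.of R R) Γ 0) :=
    (h.of_injective _ hinj).of_surjective _ (toExt_zero_surjective (M := R) powTorsion_self)
  refine h1.of_surjective
    { toFun := fun x => (Abelian.Ext.linearEquiv₀ (R := R) x).hom 1
      map_add' := fun x y => by rw [map_add]; rfl
      map_smul' := fun r x => by rw [map_smul]; rfl } fun x =>
    ⟨Abelian.Ext.mk₀ (ModuleCat.ofHom (LinearMap.toSpanSingleton R Γ x)), ?_⟩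
  exact (congrArg (fun g => g.hom (1 : R)) (LinearEquiv.apply_symm_apply
    (Abelian.Ext.linearEquiv₀ (R := R)) (ModuleCat.ofHom (LinearMap.toSpanSingleton R Γ x)))).trans
      (one_smul R x)

theorem finite_associatedPrimes_extLimit [IsNoetherianRing R] [Module.Finite R M] (t : ℕ)
    {N : ModuleCat.{u} R}
    (hN : IsWeaklyLaskerian R (Abelian.Ext ((modIdealPowers a M).obj (op 1)) N t))
    (h : ∀ i < t, IsWeaklyLaskerian R (ExtLimit (modIdealPowers a R) N i)) :
    (associatedPrimes R (ExtLimit (modIdealPowers a M) N t)).Finite := by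
  induction t generalizing N with
  | zero => exact hN.finite_associatedPrimes.subset associatedPrimes_extLimit_zero_subset
  | succ s ih =>
    have hΓ : IsWeaklyLaskerian R (powTorsion a N) :=
      isWeaklyLaskerian_powTorsion (h 0 s.succ_pos)
    have hS := (powTorsion a N).shortExact_mkQ
    set Γ : ModuleCat.{u} R := ModuleCat.of R (powTorsion a N)
    set Q : ModuleCat.{u} R := ModuleCat.of R (N ⧸ powTorsion a N)
    obtain ⟨E, f, hE, hEa, hf⟩ :=
      exists_injective_embedding_of_powTorsion_eq_bot a (powTorsion_quotient (a := a) (N := N))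
    have hEi : CategoryTheory.Injective E := Module.Injective.injective_obj E
    have hT := f.shortExact_mkQ_range hf
    set N' : ModuleCat.{u} R := ModuleCat.of R (E ⧸ LinearMap.range f)
    -- Ext^(s+1)(M/aM, Q) lies between Ext^(s+1)(M/aM, N) and Ext^(s+2)(M/aM, Γ).
    have hQ : IsWeaklyLaskerian R (Abelian.Ext ((modIdealPowers a M).obj (op 1)) Q (s + 1)) := by
      refine hN.of_exact (IsWeaklyLaskerian.ext (X := Γ) hΓ (s + 2) _)
        ((Abelian.Ext.mk₀ (ModuleCat.ofHom (powTorsion a N).mkQ)).postcompOfLinear R _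
          (add_zero (s + 1)))
        (hS.extClass.postcompOfLinear R _ (rfl : s + 1 + 1 = s + 2)) fun y => ?_
      constructor
      · exact fun hy => Abelian.Ext.covariant_sequence_exact₃ _ hS y rfl hy
      · rintro ⟨x, rfl⟩
        change (x.comp (Abelian.Ext.mk₀ _) (add_zero (s + 1))).comp hS.extClass
          (rfl : s + 1 + 1 = s + 2) = 0
        rw [Abelian.Ext.comp_assoc _ _ _ (add_zero _) (zero_add 1) (by lia), hS.comp_extClass,
          Abelian.Ext.comp_zero]
    have hN' : IsWeaklyLaskerian R (Abelian.Ext ((modIdealPowers a M).obj (op 1)) N' s) := by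
      refine hQ.of_injective (hT.extClass.postcompOfLinear R _ rfl) ?_
      rw [injective_iff_map_eq_zero]
      intro x hx
      obtain ⟨y, rfl⟩ := Abelian.Ext.covariant_sequence_exact₃ _ hT x rfl hx
      have hy : y = 0 := (ext_subsingleton_of_injective hEa s 1).elim _ _
      rw [hy, Abelian.Ext.zero_comp]
    have hinj (L : Type u) [AddCommGroup L] [Module R L] (i : ℕ) : Function.Injective
        (ExtLimit.postcomp (D := modIdealPowers a L) hT.extClass (rfl : i + 1 = i + 1)) := by
      rw [injective_iff_map_eq_zero]
      intro x hx
      obtain ⟨y, rfl⟩ := (ExtLimit.exact₃ hT i x).1 hx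
      have hy : y = 0 := (extLimit_subsingleton_of_injective hEa i).elim _ _
      rw [hy, map_zero]
    have h' : ∀ i < s, IsWeaklyLaskerian R (ExtLimit (modIdealPowers a R) N' i) := by
      intro i hi
      refine IsWeaklyLaskerian.of_injective ?_ _ (hinj R i)
      refine (h (i + 1) (Nat.succ_lt_succ hi)).of_surjective
        (ExtLimit.postcomp (Abelian.Ext.mk₀ (ModuleCat.ofHom (powTorsion a N).mkQ))
          (add_zero (i + 1))) fun y => ?_
      refine (ExtLimit.exact₃ hS (i + 1) y).1 ?_
      -- The obstruction to surjectivity lies in H^(i+2)_a(Γ), which embeds in Ext^(i+2)(R, Γ) = 0.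
      refine toExt_injective_of_powTorsion_eq_top (M := R) (i + 1 + 1) (X := Γ) powTorsion_self ?_
      have : Projective (ModuleCat.of R R) := (IsProjective.iff_projective _).1 inferInstance
      exact (Abelian.Ext.eq_zero_of_projective _).trans (Abelian.Ext.eq_zero_of_projective _).symm
    have hQfin : (associatedPrimes R (ExtLimit (modIdealPowers a M) Q (s + 1))).Finite := by
      have hsurj : Function.Surjective (ExtLimit.postcomp (D := modIdealPowers a M) hT.extClass
          (rfl : s + 1 = s + 1)) := fun y =>
        (ExtLimit.exact₁ hT s y).1 ((extLimit_subsingleton_of_injective hEa (s + 1)).elim _ _)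
      rw [← LinearEquiv.AssociatedPrimes.eq (LinearEquiv.ofBijective _ ⟨hinj M s, hsurj⟩)]
      exact ih hN' h'
    refine IsWeaklyLaskerian.finite_associatedPrimes_of_exact ?_ hQfin _ _
      (ExtLimit.exact₂ hS (s + 1))
    exact (IsWeaklyLaskerian.ext (X := Γ) hΓ (s + 1) (ModuleCat.of R M)).of_injective _
      (toExt_injective_of_powTorsion_eq_top (s + 1) powTorsion_self)

end GeneralizedLocalCohomology

end

/-! ### Cycles and homology of a cochain complex of modules -/

namespace CochainComplex

variable {R : Type u} [CommRing R] (K : CochainComplex (ModuleCat.{u} R) ℕ)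

lemma exact_toCycles_homologyπ (i n : ℕ) (h : (ComplexShape.up ℕ).prev n = i) :
    Function.Exact (K.toCycles i n) (K.homologyπ n) := by
  refine (ShortComplex.ShortExact.moduleCat_exact_iff_function_exact
    (ShortComplex.mk _ _ (K.toCycles_comp_homologyπ i n))).1 ?_
  exact ShortComplex.exact_of_g_is_cokernel _ (K.homologyIsCokernel _ n h)

lemma exact_iCycles_d (n : ℕ) : Function.Exact (K.iCycles n) (K.d n (n + 1)) := by
  refine (ShortComplex.ShortExact.moduleCat_exact_iff_function_exact
    (ShortComplex.mk _ _ (K.iCycles_d n (n + 1)))).1 ?_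
  exact ShortComplex.exact_of_f_is_kernel _ (K.cyclesIsKernel n (n + 1) (by simp))

lemma homologyπ_zero_eq_zero_iff (z : K.cycles 0) : K.homologyπ 0 z = 0 ↔ z = 0 := by
  rw [K.exact_toCycles_homologyπ 0 0 CochainComplex.prev_nat_zero,
    K.toCycles_eq_zero (i := 0) (j := 0) (by simp)]
  exact ⟨fun ⟨w, hw⟩ => hw.symm, fun h => ⟨0, h.symm⟩⟩

end CochainComplex

/-! ### Natural comparison of derived-functor Ext with `Abelian.Ext` -/

namespace CategoryTheory.ProjectiveResolution

lemma extMk_smul {R : Type*} [CommRing R] {C : Type*} [Category C] [Abelian C] [Linear R C]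
    [HasExt C] {X Y : C} (P : ProjectiveResolution X) {n m : ℕ} (r : R) (f : P.complex.X n ⟶ Y)
    (hm : n + 1 = m) (hf : P.complex.d m n ≫ f = 0) :
    P.extMk (r • f) m hm (by simp [hf]) = r • P.extMk f m hm hf := by
  rw [Abelian.Ext.smul_eq_comp_mk₀, P.extMk_comp_mk₀]
  simp

/-- Coboundaries in degree 0 factor through the degree 1 term of the resolution viewed as a cochain
complex, and that term is zero. -/
lemma extMk_zero_eq_zero_iff {C : Type*} [Category C] [Abelian C]
    [HasExt C] {X Y : C} (P : ProjectiveResolution X) (f : P.complex.X 0 ⟶ Y)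
    (hf : P.complex.d 1 0 ≫ f = 0) :
    P.extMk f 1 rfl hf = 0 ↔ f = 0 := by
  constructor
  · intro h
    rw [← P.extEquivCohomologyClass.apply_eq_iff_eq, extEquivCohomologyClass_extMk,
      extEquivCohomologyClass_zero,
      CochainComplex.HomComplex.CohomologyClass.mk_eq_zero_iff,
      CochainComplex.HomComplex.Cocycle.toSingleMk_mem_coboundaries_iff _ _ _ _ _ 1 (by lia)] at h
    obtain ⟨g, hg⟩ := h
    rw [← cancel_epi (P.cochainComplexXIso (-(0 : ℕ)) 0 rfl).hom, ← hg,
      (P.cochainComplex.isZero_of_isStrictlyLE 0 1).eq_zero_of_src g]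
    simp
  · rintro rfl
    simp

variable {R : Type u} [CommRing R] {L L' : ModuleCat.{u} R} (P : ProjectiveResolution L)
  (P' : ProjectiveResolution L') (Y : ModuleCat.{u} R) (n : ℕ)

/-- The cocycle `P.complex.X n ⟶ Y` underlying a cycle of the complex `Hom(P, Y)`. -/
noncomputable def cocycleHom (z : (P.complex.linearYonedaObj R Y).cycles n) :
    P.complex.X n ⟶ Y :=
  (P.complex.linearYonedaObj R Y).iCycles n z

lemma d_comp_cocycleHom (z : (P.complex.linearYonedaObj R Y).cycles n) :
    P.complex.d (n + 1) n ≫ P.cocycleHom Y n z = 0 :=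
  congrArg (fun φ => φ.hom z) ((P.complex.linearYonedaObj R Y).iCycles_d n (n + 1))

lemma cocycleHom_injective : Function.Injective (P.cocycleHom Y n) :=
  (ModuleCat.mono_iff_injective ((P.complex.linearYonedaObj R Y).iCycles n)).1 inferInstance

lemma cocycleHom_toCycles (p : ℕ) (w : P.complex.X p ⟶ Y) :
    P.cocycleHom Y n ((P.complex.linearYonedaObj R Y).toCycles p n w) = P.complex.d n p ≫ w :=
  congrArg (fun φ => φ.hom w) ((P.complex.linearYonedaObj R Y).toCycles_i p n)

/-- The extension class of a cycle of `Hom(P, Y)`. -/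
noncomputable def cyclesToExt :
    (P.complex.linearYonedaObj R Y).cycles n →ₗ[R] Abelian.Ext L Y n where
  toFun z := P.extMk (P.cocycleHom Y n z) (n + 1) rfl (P.d_comp_cocycleHom Y n z)
  map_add' z w := by
    rw [add_extMk]
    congr 1
    exact map_add ((P.complex.linearYonedaObj R Y).iCycles n).hom z w
  map_smul' r z := by
    rw [RingHom.id_apply, ← extMk_smul]
    congr 1
    exact map_smul ((P.complex.linearYonedaObj R Y).iCycles n).hom r z

/-- On both sides, vanishing means that the cocycle factors through the preceding differential;
degree 0 has none, so there the cocycle itself must vanish. -/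
lemma cyclesToExt_eq_zero_iff (z : (P.complex.linearYonedaObj R Y).cycles n) :
    P.cyclesToExt Y n z = 0 ↔ (P.complex.linearYonedaObj R Y).homologyπ n z = 0 := by
  cases n with
  | zero =>
    refine (P.extMk_zero_eq_zero_iff _ (P.d_comp_cocycleHom Y 0 z)).trans
      (Iff.trans ?_ (CochainComplex.homologyπ_zero_eq_zero_iff _ z).symm)
    rw [← (P.cocycleHom_injective Y 0).eq_iff (b := 0)]
    exact Eq.congr_right (map_zero ((P.complex.linearYonedaObj R Y).iCycles 0).hom).symm
  | succ p =>
    refine (P.extMk_eq_zero_iff _ _ rfl (P.d_comp_cocycleHom Y (p + 1) z) p rfl).trans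
      (Iff.trans ?_ (CochainComplex.exact_toCycles_homologyπ _ p (p + 1)
        (CochainComplex.prev_nat_succ p) z).symm)
    refine exists_congr fun w => ?_
    rw [← P.cocycleHom_toCycles]
    exact (P.cocycleHom_injective Y (p + 1)).eq_iff

lemma cyclesToExt_surjective : Function.Surjective (P.cyclesToExt Y n) := by
  intro x
  obtain ⟨f, hf, rfl⟩ := P.extMk_surjective x (n + 1) rfl
  obtain ⟨z, hz⟩ := (CochainComplex.exact_iCycles_d (P.complex.linearYonedaObj R Y) n f).1 hf
  obtain rfl : P.cocycleHom Y n z = f := hz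
  exact ⟨z, rfl⟩

lemma homologyπ_surjective (K : CochainComplex (ModuleCat.{u} R) ℕ) :
    Function.Surjective (K.homologyπ n) :=
  (ModuleCat.epi_iff_surjective _).1 inferInstance

/-- The cohomology of `Hom(P, Y)` is `Ext`. -/
noncomputable def homologyEquivExt :
    (P.complex.linearYonedaObj R Y).homology n ≃ₗ[R] Abelian.Ext L Y n :=
  ((LinearMap.quotKerEquivOfSurjective _
    (homologyπ_surjective n (P.complex.linearYonedaObj R Y))).symm.trans
      (Submodule.quotEquivOfEq _ _ (by
        ext z
        exact (P.cyclesToExt_eq_zero_iff Y n z).symm))).trans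
      (LinearMap.quotKerEquivOfSurjective _ (P.cyclesToExt_surjective Y n))

lemma homologyEquivExt_homologyπ (z : (P.complex.linearYonedaObj R Y).cycles n) :
    P.homologyEquivExt Y n ((P.complex.linearYonedaObj R Y).homologyπ n z) =
      P.cyclesToExt Y n z := by
  have h : (LinearMap.quotKerEquivOfSurjective _
      (homologyπ_surjective n (P.complex.linearYonedaObj R Y))).symm
      ((P.complex.linearYonedaObj R Y).homologyπ n z) = Submodule.Quotient.mk z := by
    rw [LinearEquiv.symm_apply_eq]
    rfl
  simp only [homologyEquivExt, LinearEquiv.trans_apply]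
  rw [h]
  rfl

variable {Y}

/-- The cochain map `Hom(P, Y) ⟶ Hom(P', Y)` induced by a chain map `P' ⟶ P`. -/
noncomputable def linearYonedaMap (φ : P'.complex ⟶ P.complex) (Y : ModuleCat.{u} R) :
    P.complex.linearYonedaObj R Y ⟶ P'.complex.linearYonedaObj R Y :=
  (HomologicalComplex.unopFunctor _ _).map
    ((((linearYoneda R (ModuleCat.{u} R)).obj Y).rightOp.mapHomologicalComplex _).map φ).op

lemma homologyEquivExt_naturality {g : L' ⟶ L} (φ : Hom P' P g)
    (x : (P.complex.linearYonedaObj R Y).homology n) :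
    P'.homologyEquivExt Y n (HomologicalComplex.homologyMap (linearYonedaMap P P' φ.hom Y) n x) =
      (Abelian.Ext.mk₀ g).comp (P.homologyEquivExt Y n x) (zero_add n) := by
  obtain ⟨z, rfl⟩ := homologyπ_surjective n _ x
  have h1 : HomologicalComplex.homologyMap (linearYonedaMap P P' φ.hom Y) n
      ((P.complex.linearYonedaObj R Y).homologyπ n z) =
      (P'.complex.linearYonedaObj R Y).homologyπ n
        (HomologicalComplex.cyclesMap (linearYonedaMap P P' φ.hom Y) n z) :=
    congrArg (fun ψ => ψ.hom z)
      (HomologicalComplex.homologyπ_naturality (linearYonedaMap P P' φ.hom Y) n)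
  rw [h1, homologyEquivExt_homologyπ, homologyEquivExt_homologyπ]
  refine Eq.trans ?_ (mk₀_comp_extMk _ _ rfl (P.d_comp_cocycleHom Y n z) φ).symm
  have h2 : P'.cocycleHom Y n (HomologicalComplex.cyclesMap (linearYonedaMap P P' φ.hom Y) n z) =
      φ.hom.f n ≫ P.cocycleHom Y n z :=
    congrArg (fun ψ => ψ.hom z)
      (HomologicalComplex.cyclesMap_i (linearYonedaMap P P' φ.hom Y) n)
  change P'.extMk _ _ rfl (P'.d_comp_cocycleHom Y n _) = _
  congr 1

lemma iso_square {C : Type*} [Category C] {A B A' B' : C} (e : A ≅ B) (e' : A' ≅ B')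
    (f : B ⟶ B') (k : A ⟶ A') (h : k ≫ e'.hom = e.hom ≫ f) : f ≫ e'.inv = e.inv ≫ k := by
  rw [Iso.comp_inv_eq, Category.assoc, h, Iso.inv_hom_id_assoc]

lemma comp_square {C : Type*} [Category C] {A₁ A₂ B₁ B₂ D₁ D₂ : C} {a : A₁ ⟶ A₂} {b : A₁ ⟶ B₁}
    {b' : A₂ ⟶ B₂} {c : B₁ ⟶ B₂} {d : B₁ ⟶ D₁} {d' : B₂ ⟶ D₂} {k : D₁ ⟶ D₂}
    (h : a ≫ b' = b ≫ c) (h' : c ≫ d' = d ≫ k) : a ≫ b' ≫ d' = (b ≫ d) ≫ k := by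
  rw [reassoc_of% h, h', Category.assoc]

/-- Two naturality squares are pasted: one for computing left derived functors by a resolution, one
for exchanging homology with passage to the opposite category. -/
lemma isoExt_hom_naturality {g : L' ⟶ L} (φ : Hom P' P g) :
    ((Ext R (ModuleCat.{u} R) n).map g.op).app Y ≫ (P'.isoExt n Y).hom =
      (P.isoExt n Y).hom ≫ HomologicalComplex.homologyMap (linearYonedaMap P P' φ.hom Y) n := by
  have h1 := congrArg Quiver.Hom.unop (ProjectiveResolution.isoLeftDerivedObj_inv_naturality g P' P
    φ.hom φ.hom_f_zero_comp_π_f_zero ((linearYoneda R (ModuleCat.{u} R)).obj Y).rightOp n)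
  have h2 := congrArg Quiver.Hom.unop
    (HomologicalComplex.homologyOp_hom_naturality (linearYonedaMap P P' φ.hom Y) n)
  set F := ((linearYoneda R (ModuleCat.{u} R)).obj Y).rightOp
  set ψ := linearYonedaMap P P' φ.hom Y
  exact comp_square h1 (iso_square (HomologicalComplex.homologyUnop
    ((F.mapHomologicalComplex _).obj P.complex) n) (HomologicalComplex.homologyUnop
    ((F.mapHomologicalComplex _).obj P'.complex) n) _ _ h2.symm)

/-- The derived functor `Ext` is computed by `Abelian.Ext`. -/
noncomputable def extObjEquiv (L Y : ModuleCat.{u} R) (n : ℕ) :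
    ((Ext R (ModuleCat.{u} R) n).obj (Opposite.op L)).obj Y ≃ₗ[R] Abelian.Ext L Y n :=
  ((projectiveResolution L).isoExt n Y).toLinearEquiv.trans
    ((projectiveResolution L).homologyEquivExt Y n)

lemma extObjEquiv_naturality (g : L' ⟶ L)
    (x : ((Ext R (ModuleCat.{u} R) n).obj (Opposite.op L)).obj Y) :
    extObjEquiv L' Y n (((Ext R (ModuleCat.{u} R) n).map g.op).app Y x) =
      (Abelian.Ext.mk₀ g).comp (extObjEquiv L Y n x) (zero_add n) := by
  let φ : Hom (projectiveResolution L') (projectiveResolution L) g :=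
    { hom := lift g _ _
      hom_f_zero_comp_π_f_zero := lift_commutes_zero g _ _ }
  have h := congrArg (fun ψ => ψ.hom x)
    (isoExt_hom_naturality (projectiveResolution L) (projectiveResolution L') (Y := Y) n φ)
  refine Eq.trans ?_ (homologyEquivExt_naturality _ _ n φ _)
  exact congrArg ((projectiveResolution L').homologyEquivExt Y n) h

end CategoryTheory.ProjectiveResolution

/-! ### Identification of the colimits of functors with `ExtLimit` -/

section

open Opposite

variable {R : Type u} [CommRing R] (D : ℕᵒᵖ ⥤ ModuleCat.{u} R) (X : ModuleCat.{u} R) (i : ℕ)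

/-- The direct system `n ↦ Ext^i(D n, X)`, in terms of the derived functors of `Hom`. -/
noncomputable abbrev extDiagram : ℕᵒᵖᵒᵖ ⥤ ModuleCat.{u} R :=
  (D.op ⋙ Ext R (ModuleCat.{u} R) i).flip.obj X

lemma extDiagram_map_eq {m n : ℕ} (h : m ≤ n) (x : (extDiagram D X i).obj (op (op m))) :
    ProjectiveResolution.extObjEquiv (D.obj (op n)) X i
      ((extDiagram D X i).map (homOfLE h).op.op x) =
    (Abelian.Ext.mk₀ (D.map (homOfLE h).op)).comp
      (ProjectiveResolution.extObjEquiv (D.obj (op m)) X i x) (zero_add i) :=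
  ProjectiveResolution.extObjEquiv_naturality i (D.map (homOfLE h).op) x

/-- The colimit of the derived functors `Ext^i(D n, X)` maps to `ExtLimit D X i`. -/
noncomputable def colimitToExtLimit :
    Limits.colimit (extDiagram D X i) ⟶ ModuleCat.of R (ExtLimit D X i) :=
  Limits.colimit.desc (extDiagram D X i)
    { pt := ModuleCat.of R (ExtLimit D X i)
      ι :=
        { app n := ModuleCat.ofHom ((ExtLimit.of n.unop.unop).comp
            (ProjectiveResolution.extObjEquiv (D.obj (op n.unop.unop)) X i).toLinearMap)
          naturality m n f := by
            refine ModuleCat.hom_ext (LinearMap.ext fun x => ?_)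
            have h := extDiagram_map_eq D X i f.unop.unop.le x
            refine (congrArg (ExtLimit.of n.unop.unop) h).trans ?_
            exact ExtLimit.of_comp_eq f.unop.unop.le _ } }

lemma colimitToExtLimit_ι (n : ℕ) (x : (extDiagram D X i).obj (op (op n))) :
    (colimitToExtLimit D X i).hom ((Limits.colimit.ι (extDiagram D X i) (op (op n))).hom x) =
      ExtLimit.of n (ProjectiveResolution.extObjEquiv (D.obj (op n)) X i x) := by
  have h : Limits.colimit.ι (extDiagram D X i) (op (op n)) ≫ colimitToExtLimit D X i =
      ModuleCat.ofHom ((ExtLimit.of n).comp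
        (ProjectiveResolution.extObjEquiv (D.obj (op n)) X i).toLinearMap) :=
    Limits.colimit.ι_desc _ _
  exact LinearMap.congr_fun (congrArg ModuleCat.Hom.hom h) x

/-- The inverse of `colimitToExtLimit`. -/
noncomputable def extLimitToColimit :
    ExtLimit D X i →ₗ[R] (Limits.colimit (extDiagram D X i) :) :=
  Module.DirectLimit.lift R ℕ (fun n => Abelian.Ext (D.obj (op n)) X i)
    (fun m n h => extTransition D X i m n h)
    (fun n => (Limits.colimit.ι (extDiagram D X i) (op (op n))).hom.comp
      (ProjectiveResolution.extObjEquiv (D.obj (op n)) X i).symm.toLinearMap) fun m n h x => by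
      obtain ⟨x, rfl⟩ := (ProjectiveResolution.extObjEquiv (D.obj (op m)) X i).surjective x
      have h1 : (ProjectiveResolution.extObjEquiv (D.obj (op n)) X i).symm
          (extTransition D X i m n h (ProjectiveResolution.extObjEquiv (D.obj (op m)) X i x)) =
          (extDiagram D X i).map (homOfLE h).op.op x :=
        (LinearEquiv.symm_apply_eq _).2 (extDiagram_map_eq D X i h x).symm
      refine (congrArg (Limits.colimit.ι (extDiagram D X i) (op (op n))).hom h1).trans ?_
      refine (LinearMap.congr_fun (congrArg ModuleCat.Hom.hom
        (Limits.colimit.w (extDiagram D X i) (homOfLE h).op.op)) x).trans ?_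
      exact congrArg (Limits.colimit.ι (extDiagram D X i) (op (op m))).hom
        (LinearEquiv.symm_apply_apply _ x).symm

lemma extLimitToColimit_of (n : ℕ) (x : Abelian.Ext (D.obj (op n)) X i) :
    extLimitToColimit D X i (ExtLimit.of n x) =
      (Limits.colimit.ι (extDiagram D X i) (op (op n))).hom
        ((ProjectiveResolution.extObjEquiv (D.obj (op n)) X i).symm x) :=
  Module.DirectLimit.lift_of (R := R) (G := fun n => Abelian.Ext (D.obj (op n)) X i)
    (f := fun m n h => extTransition D X i m n h) _ _ x

/-- The colimit of the derived functors `Ext^i(D n, X)` is `ExtLimit D X i`. -/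
noncomputable def colimitExtDiagramEquiv :
    (Limits.colimit (extDiagram D X i) :) ≃ₗ[R] ExtLimit D X i :=
  LinearEquiv.ofLinearMap (colimitToExtLimit D X i).hom (extLimitToColimit D X i)
    (LinearMap.ext fun x => by
      obtain ⟨n, x, rfl⟩ := ExtLimit.exists_of x
      rw [LinearMap.comp_apply, extLimitToColimit_of]
      refine (colimitToExtLimit_ι D X i n _).trans ?_
      rw [LinearEquiv.apply_symm_apply, LinearMap.id_apply])
    (ModuleCat.hom_ext_iff.1 (Limits.colimit.hom_ext (F := extDiagram D X i)
      (f := colimitToExtLimit D X i ≫ ModuleCat.ofHom (extLimitToColimit D X i)) (f' := 𝟙 _)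
      fun n => ModuleCat.hom_ext <| LinearMap.ext fun x =>
        (congrArg (extLimitToColimit D X i) (colimitToExtLimit_ι D X i n.unop.unop x)).trans <|
          (extLimitToColimit_of D X i n.unop.unop _).trans <|
            congrArg (Limits.colimit.ι (extDiagram D X i) n).hom
              (LinearEquiv.symm_apply_apply _ x)))

/-- The colimit of the functors `Ext^i(D n, -)`, evaluated at `X`, is `ExtLimit D X i`. -/
noncomputable def colimitEquivExtLimit :
    (Limits.colimit (D.op ⋙ Ext R (ModuleCat.{u} R) i)).obj X ≃ₗ[R] ExtLimit D X i :=
  (Limits.colimitObjIsoColimitCompEvaluation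
    (D.op ⋙ Ext R (ModuleCat.{u} R) i) X).toLinearEquiv.trans
    (colimitExtDiagramEquiv D X i)

open GeneralizedLocalCohomology

/-- Generalized local cohomology in terms of `ExtLimit`. -/
noncomputable def generalizedLocalCohomologyEquiv (a : Ideal R) (M : Type u) [AddCommGroup M]
    [Module R M] :
    (generalizedLocalCohomology a i M).obj X ≃ₗ[R] ExtLimit (modIdealPowers a M) X i :=
  colimitEquivExtLimit (modIdealPowers a M) X i

/-- The inverse systems `R ⧸ a ^ n` and `R ⧸ a ^ n • R` are isomorphic. -/
noncomputable def ringModIdealsIso (a : Ideal R) :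
    localCohomology.ringModIdeals (localCohomology.idealPowersDiagram a) ≅ modIdealPowers a R :=
  NatIso.ofComponents (fun n => (Submodule.quotEquivOfEq (a ^ n.unop)
    (a ^ n.unop • (⊤ : Submodule R R)) (by rw [smul_eq_mul, Ideal.mul_top])).toModuleIso)
    fun f => by
      refine ModuleCat.hom_ext (LinearMap.ext fun x => ?_)
      obtain ⟨x, rfl⟩ := Submodule.mkQ_surjective _ x
      rfl

/-- Local cohomology in terms of `ExtLimit`. -/
noncomputable def localCohomologyEquiv (a : Ideal R) :
    (localCohomology a i).obj X ≃ₗ[R] ExtLimit (modIdealPowers a R) X i :=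
  ((Limits.HasColimit.isoOfNatIso (Functor.isoWhiskerRight (NatIso.op (ringModIdealsIso a)).symm
    (Ext R (ModuleCat.{u} R) i))).app X).toLinearEquiv.trans
      (colimitEquivExtLimit (modIdealPowers a R) X i)

end

/-! ### The theorem -/

theorem corollary2p4 {R : Type u} [CommRing R] [IsNoetherianRing R] (a : Ideal R)
    (M : Type u) [AddCommGroup M] [Module R M] [Module.Finite R M]
    (N : Type u) [AddCommGroup N] [Module R N] (hN : IsWeaklyLaskerian R N) (t : ℕ) :
    ((∀ i < t, IsWeaklyLaskerian R ((localCohomology a i).obj (ModuleCat.of R N))) →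
      (associatedPrimes R
        ((generalizedLocalCohomology a t M).obj (ModuleCat.of R N))).Finite) ∧
    ((∀ i < t, Module.Finite R ((localCohomology a i).obj (ModuleCat.of R N)) ∨
        (Module.support R ((localCohomology a i).obj (ModuleCat.of R N))).Finite) →
      (associatedPrimes R
        ((generalizedLocalCohomology a t M).obj (ModuleCat.of R N))).Finite) := by
  have main (h : ∀ i < t, IsWeaklyLaskerian R ((localCohomology a i).obj (ModuleCat.of R N))) :
      (associatedPrimes R ((generalizedLocalCohomology a t M).obj (ModuleCat.of R N))).Finite := by
    rw [LinearEquiv.AssociatedPrimes.eq (generalizedLocalCohomologyEquiv (ModuleCat.of R N) t a M)]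
    refine GeneralizedLocalCohomology.finite_associatedPrimes_extLimit t
      (IsWeaklyLaskerian.ext (X := ModuleCat.of R N) hN t _) fun i hi => ?_
    exact (h i hi).of_surjective (localCohomologyEquiv (ModuleCat.of R N) i a).toLinearMap
      (localCohomologyEquiv (ModuleCat.of R N) i a).surjective
  refine ⟨main, fun h => main fun i hi => ?_⟩
  rcases h i hi with h | h
  · exact IsWeaklyLaskerian.of_finite
  · exact IsWeaklyLaskerian.of_finite_support h
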